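/- Let $E$ be a real Banach space with norm $\|\cdot\|$ and let $(e_n)_{n\ge 1}$ be a (Schauder) basis of $E$. A real Banach space is called polyhedral if the closed unit ball of each of its finite dimensional subspaces is a polyhedron (a finite intersection of closed half-spaces), and $E$ is called isomorphically polyhedral if it is linearly homeomorphic to a polyhedral Banach space. The basis $(e_n)$ is shrinking if its biorthogonal functionals form a Schauder basis of the dual $E'$, and unconditional if the expansion $x=\sum_n a_ne_n$ of every $x\in E$ converges unconditionally. Suppose that $(e_n)$ is shrinking. Then the following are equivalent: (a) $E$ is isomorphically polyhedral; (b) there is a norm $|||\cdot|||$ on $E$, equivalent to $\|\cdot\|$, such that $(e_n)$ is monotone with respect to $|||\cdot|||$, i.e. $|||\sum_{n=1}^{k}a_ne_n|||\le|||\sum_{n=1}^{k+1}a_ne_n|||$ for every real sequence $(a_n)$ and every $k\in\mathbb N$, and such that for every $x=\sum_{n=1}^\infty a_ne_n\in E$ there is an $m\in\mathbb N$ with $|||\sum_{n=1}^{\infty}a_ne_n|||=|||\sum_{n=1}^{m}a_ne_n|||$. Moreover, (a) and (b) are also equivalent if, instead of shrinking, $(e_n)$ is assumed to be unconditional. -/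

import Mathlib

open Filter Topology

universe u

/-- A polyhedron: an intersection of finitely many closed half-spaces `{x | f x ≤ c}`. -/
def IsPolyhedron {V : Type*} [NormedAddCommGroup V] [NormedSpace ℝ V] (S : Set V) : Prop :=
  ∃ H : Finset (StrongDual ℝ V × ℝ), S = {x | ∀ h ∈ H, h.1 x ≤ h.2}

/-- A real normed space is polyhedral if the closed unit ball of each of its finite dimensional
subspaces is a polyhedron (in that subspace). -/
def IsPolyhedralSpace (X : Type*) [NormedAddCommGroup X] [NormedSpace ℝ X] : Prop :=
  ∀ F : Submodule ℝ X, FiniteDimensional ℝ F → IsPolyhedron (Metric.closedBall (0 : F) 1)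

/-- A Banach space is isomorphically polyhedral if it is linearly homeomorphic to a polyhedral
Banach space. -/
def IsIsomorphicallyPolyhedral (E : Type u) [NormedAddCommGroup E] [NormedSpace ℝ E] : Prop :=
  ∃ (X : Type u) (_ : NormedAddCommGroup X) (_ : NormedSpace ℝ X),
    CompleteSpace X ∧ IsPolyhedralSpace X ∧ Nonempty (E ≃L[ℝ] X)

section

variable {E : Type*} [NormedAddCommGroup E] [NormedSpace ℝ E]

/-- `p` is a norm on `E` that is equivalent to the given norm. -/
def IsEquivalentNorm (p : Seminorm ℝ E) : Prop :=
  ∃ c C : ℝ, 0 < c ∧ 0 < C ∧ ∀ x : E, c * ‖x‖ ≤ p x ∧ p x ≤ C * ‖x‖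

/-- The sequence `e` is monotone with respect to `p`. -/
def IsMonotoneFor (e : ℕ → E) (p : Seminorm ℝ E) : Prop :=
  ∀ (a : ℕ → ℝ) (k : ℕ),
    p (∑ i ∈ Finset.range k, a i • e i) ≤ p (∑ i ∈ Finset.range (k + 1), a i • e i)

/-- A basis is shrinking if its biorthogonal functionals form a Schauder basis of the dual. -/
def IsShrinkingBasis (b : SchauderBasis ℝ E) : Prop :=
  ∃ B : SchauderBasis ℝ (StrongDual ℝ E), ∀ n : ℕ, B n = b.coord n

/-- A basis is unconditional if the expansion of every vector converges unconditionally. -/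
def IsUnconditionalBasis (b : SchauderBasis ℝ E) : Prop :=
  ∀ x : E, HasSum (fun n : ℕ => b.coord n x • b n) x

/-- There is an equivalent norm for which the basis is monotone and for which the norm of every
vector equals the norm of one of the partial sums of its expansion. -/
def HasMonotoneAttainingRenorming (b : SchauderBasis ℝ E) : Prop :=
  ∃ p : Seminorm ℝ E, IsEquivalentNorm p ∧ IsMonotoneFor b p ∧
    ∀ x : E, ∃ m : ℕ, p x = p (∑ i ∈ Finset.range m, b.coord i x • b i)

end

/-! From (a) to (b): a separable polyhedral Banach space has a countable boundary, that is,
countably many functionals of norm at most one such that at each point one of them equals the norm.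
A polyhedral norm is affine on a short piece of every ray; Baire category upgrades this to local
linearity on a dense open set, and separability leaves countably many linear pieces
(`IsPolyhedralSpace.exists_countable_boundary`). By Ekeland's principle such a boundary spans a
dense subspace of the dual (`dense_span_range_of_boundary`), so the dual is separable.

Both hypotheses on the basis serve one purpose: the coordinate functionals span a dense subspace of
the dual. For a shrinking basis this is immediate; for an unconditional one, failure would produce
uncountably many uniformly separated functionals in a separable dual. The boundary functionals,
inflated by 1 + 2⁻ⁿ, can then be approximated by finitely supported gₙ; the inflation absorbs the
errors, so sup |gₙ| is still attained at every point. The supremum of all |gₙ ∘ Pₖ|, with Pₖ the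
basis projections, is the norm in (b) (`hasMonotoneAttainingRenorming_of_boundary`).

From (b) to (a): level n receives finitely many functionals that almost norm the range of Pₙ, with
weights decreasing strictly to 1. If the norm of x is attained at Pₘx, level m strictly beats all
later levels near x, so the new norm is locally a maximum of finitely many functionals
(`HasMonotoneAttainingRenorming.exists_locally_finite`). Compactness of finite dimensional spheres
then makes it polyhedral. -/

/-- If the unit ball is a polyhedron, the norm is a maximum of finitely many functionals. -/
theorem IsPolyhedron.exists_finset_norm_eq {V : Type*} [NormedAddCommGroup V] [NormedSpace ℝ V]
    (h : IsPolyhedron (Metric.closedBall (0 : V) 1)) :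
    ∃ Φ : Finset (StrongDual ℝ V), (∀ φ ∈ Φ, ∀ z, φ z ≤ ‖z‖) ∧ ∀ z, ∃ φ ∈ Φ, φ z = ‖z‖ := by
  classical
  obtain ⟨H, hH⟩ := h
  have mem : ∀ z : V, ‖z‖ ≤ 1 ↔ ∀ h ∈ H, h.1 z ≤ h.2 := fun z => by
    rw [← mem_closedBall_zero_iff, hH, Set.mem_ofPred_eq]
  have le : ∀ h ∈ H, ∀ z : V, h.1 z ≤ h.2 * ‖z‖ := by
    intro h hh z
    rcases eq_or_ne z 0 with rfl | hz
    · simp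
    · have hz' := norm_pos_iff.2 hz
      have := (mem (‖z‖⁻¹ • z)).1 (by rw [norm_smul, norm_inv, norm_norm,
        inv_mul_cancel₀ hz'.ne']) h hh
      rw [map_smul, smul_eq_mul, inv_mul_le_iff₀ hz'] at this
      linarith
  have nn : ∀ h ∈ H, 0 ≤ h.2 := fun h hh => by simpa using (mem 0).1 (by simp) h hh
  -- A half-space with bound zero contributes the zero functional, as `0⁻¹ = 0`. Inserting `0` makes
  -- the maximum below nonnegative, hence `s` positive.
  refine ⟨insert 0 (H.image fun h => h.2⁻¹ • h.1), ?_, ?_⟩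
  · intro φ hφ z
    rw [Finset.mem_insert, Finset.mem_image] at hφ
    rcases hφ with rfl | ⟨h, hh, rfl⟩
    · simp
    · rcases (nn h hh).eq_or_lt with h0 | h0
      · simp [← h0]
      · simpa [inv_mul_le_iff₀ h0] using le h hh z
  · intro z
    by_contra! hne
    have hlt : ∀ φ ∈ insert 0 (H.image fun h => h.2⁻¹ • h.1), φ z < ‖z‖ := by
      intro φ hφ
      refine lt_of_le_of_ne ?_ (hne φ hφ)
      rw [Finset.mem_insert, Finset.mem_image] at hφ
      rcases hφ with rfl | ⟨h, hh, rfl⟩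
      · simp
      · rcases (nn h hh).eq_or_lt with h0 | h0
        · simp [← h0]
        · simpa [inv_mul_le_iff₀ h0] using le h hh z
    obtain ⟨φ, hφ, hmax⟩ := Finset.exists_max_image _
      (fun φ : StrongDual ℝ V => φ z) (Finset.insert_nonempty 0 (H.image fun h => h.2⁻¹ • h.1))
    -- Then `s⁻¹ • z` satisfies every half-space constraint although its norm exceeds one.
    obtain ⟨s, hs1, hs2⟩ := exists_between (hlt φ hφ)
    have hs0 : 0 < s := lt_of_le_of_lt (by simpa using hmax 0 (by simp)) hs1
    have : ‖s⁻¹ • z‖ ≤ 1 := by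
      rw [mem]
      intro h hh
      rcases (nn h hh).eq_or_lt with h0 | h0
      · have := le h hh (s⁻¹ • z)
        rwa [← h0, zero_mul, h0] at this
      · have := (hmax (h.2⁻¹ • h.1) (Finset.mem_insert_of_mem
          (Finset.mem_image_of_mem _ hh))).trans hs1.le
        rw [smul_apply, smul_eq_mul, inv_mul_le_iff₀ h0] at this
        rw [map_smul, smul_eq_mul, inv_mul_le_iff₀ hs0]
        linarith
    rw [norm_smul, norm_inv, Real.norm_eq_abs, abs_of_pos hs0, inv_mul_le_iff₀ hs0] at this
    linarith

/-- Among finitely many affine functions, one is maximal to the right of zero. -/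
theorem Finset.exists_eventually_affine_le {ι : Type*} (s : Finset ι) (hs : s.Nonempty)
    (a b : ι → ℝ) :
    ∃ i ∈ s, ∀ᶠ t in 𝓝[>] (0 : ℝ), ∀ j ∈ s, a j + t * b j ≤ a i + t * b i := by
  -- The larger value at zero wins for small `t`; slopes break ties.
  have two : ∀ i j, (∀ᶠ t in 𝓝[>] (0 : ℝ), a j + t * b j ≤ a i + t * b i) ∨
      ∀ᶠ t in 𝓝[>] (0 : ℝ), a i + t * b i ≤ a j + t * b j := by
    have strict : ∀ i j, a i < a j →
        ∀ᶠ t in 𝓝[>] (0 : ℝ), a i + t * b i ≤ a j + t * b j := by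
      intro i j h
      have : ∀ᶠ t in 𝓝 (0 : ℝ), a i + t * b i < a j + t * b j :=
        ContinuousAt.eventually_lt (by fun_prop) (by fun_prop) (by simpa using h)
      exact (this.filter_mono nhdsWithin_le_nhds).mono fun _ h => h.le
    intro i j
    rcases lt_trichotomy (a i) (a j) with h | h | h
    · exact Or.inr (strict i j h)
    · rcases le_total (b i) (b j) with hb | hb
      · refine Or.inr (eventually_mem_nhdsWithin.mono fun t ht => ?_)
        have := mul_le_mul_of_nonneg_left hb (le_of_lt (Set.mem_Ioi.1 ht))
        linarith
      · refine Or.inl (eventually_mem_nhdsWithin.mono fun t ht => ?_)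
        have := mul_le_mul_of_nonneg_left hb (le_of_lt (Set.mem_Ioi.1 ht))
        linarith
    · exact Or.inl (strict j i h)
  induction hs using Finset.Nonempty.cons_induction with
  | singleton i => exact ⟨i, by simp, by simp⟩
  | cons i s hi hs ih =>
    obtain ⟨k, hk, hmax⟩ := ih
    rcases two i k with h | h
    · refine ⟨i, by simp, ?_⟩
      filter_upwards [h, hmax] with t h1 h2 j hj
      rcases Finset.mem_cons.1 hj with rfl | hj
      · exact le_rfl
      · exact (h2 j hj).trans h1
    · refine ⟨k, by simp [hk], ?_⟩
      filter_upwards [h, hmax] with t h1 h2 j hj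
      rcases Finset.mem_cons.1 hj with rfl | hj
      · exact h1
      · exact h2 j hj

/-! ### Countable boundaries of separable polyhedral spaces -/

section Polyhedral

variable {X : Type*} [NormedAddCommGroup X] [NormedSpace ℝ X]

/-- A polyhedral norm is affine on a short initial piece of every ray. -/
theorem IsPolyhedralSpace.exists_norm_add_smul_eq (hX : IsPolyhedralSpace X) (x y : X) :
    ∃ δ > 0, ∃ c : ℝ, ∀ t, 0 ≤ t → t ≤ δ → ‖x + t • y‖ = ‖x‖ + t * c := by
  let F := Submodule.span ℝ ({x, y} : Set X)
  have : FiniteDimensional ℝ F := FiniteDimensional.span_of_finite ℝ (by simp)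
  obtain ⟨Φ, hle, heq⟩ := (hX F this).exists_finset_norm_eq
  let x' : F := ⟨x, Submodule.subset_span (by simp)⟩
  let y' : F := ⟨y, Submodule.subset_span (by simp)⟩
  have hne : Φ.Nonempty := by obtain ⟨φ, hφ, -⟩ := heq 0; exact ⟨φ, hφ⟩
  obtain ⟨φ, hφ, hev⟩ := Φ.exists_eventually_affine_le hne (fun φ => φ x') (fun φ => φ y')
  have key : ∀ᶠ t in 𝓝[>] (0 : ℝ), ‖x + t • y‖ = φ x' + t * φ y' := by
    filter_upwards [hev] with t ht
    change ‖x' + t • y'‖ = _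
    obtain ⟨ψ, hψ, h⟩ := heq (x' + t • y')
    have h1 := ht ψ hψ
    have h2 := hle φ hφ (x' + t • y')
    rw [← h] at h2 ⊢
    simp only [map_add, map_smul, smul_eq_mul] at h2 ⊢
    exact le_antisymm h1 h2
  have hx : φ x' = ‖x‖ := by
    have h1 : Tendsto (fun t : ℝ => ‖x + t • y‖) (𝓝[>] 0) (𝓝 ‖x‖) := by
      have : Continuous fun t : ℝ => ‖x + t • y‖ := by fun_prop
      simpa using (this.tendsto 0).mono_left nhdsWithin_le_nhds
    have h2 : Tendsto (fun t : ℝ => φ x' + t * φ y') (𝓝[>] 0) (𝓝 (φ x')) := by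
      have : Continuous fun t : ℝ => φ x' + t * φ y' := by fun_prop
      simpa using (this.tendsto 0).mono_left nhdsWithin_le_nhds
    exact tendsto_nhds_unique (h2.congr' (key.mono fun _ h => h.symm)) h1
  obtain ⟨δ, hδ, hsub⟩ := mem_nhdsGT_iff_exists_Ioc_subset.1 key
  refine ⟨δ, hδ, φ y', fun t h0 h1 => ?_⟩
  rcases h0.eq_or_lt with rfl | h0
  · simp
  · rw [← hx]; exact hsub ⟨h0, h1⟩

/-- In direction `y`, the one-sided slopes of the norm at `x` differ by less than `ε`. -/
def slopeGapLt (y : X) (ε : ℝ) : Set X :=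
  {x | ∃ t > 0, ‖x + t • y‖ + ‖x - t • y‖ - 2 * ‖x‖ < t * ε}

theorem isOpen_slopeGapLt (y : X) (ε : ℝ) : IsOpen (slopeGapLt y ε) := by
  have : slopeGapLt y ε =
      ⋃ t : Set.Ioi (0 : ℝ), {x : X | ‖x + (t : ℝ) • y‖ + ‖x - (t : ℝ) • y‖ - 2 * ‖x‖ < t * ε} := by
    ext x; simp [slopeGapLt]
  rw [this]
  exact isOpen_iUnion fun t => isOpen_lt (by fun_prop) (by fun_prop)

/-- If the norm is affine on the segment from `x` to `x + δ • y`, then at `x + t • y` with `t < δ /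
2` the gap for step `t` is zero, because both endpoints `x` and `x + 2t • y` lie on that segment. -/
theorem IsPolyhedralSpace.dense_slopeGapLt (hX : IsPolyhedralSpace X) (y : X) {ε : ℝ}
    (hε : 0 < ε) : Dense (slopeGapLt y ε) := by
  intro x
  obtain ⟨δ, hδ, c, hc⟩ := hX.exists_norm_add_smul_eq x y
  have h1 : Tendsto (fun t : ℝ => x + t • y) (𝓝[>] 0) (𝓝 x) := by
    have : Continuous fun t : ℝ => x + t • y := by fun_prop
    simpa using (this.tendsto 0).mono_left nhdsWithin_le_nhds
  refine mem_closure_of_tendsto h1 ?_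
  filter_upwards [Ioo_mem_nhdsGT (half_pos hδ)] with t ht
  refine ⟨t, ht.1, ?_⟩
  have e1 : x + t • y + t • y = x + (2 * t) • y := by module
  have e2 : x + t • y - t • y = x + (0 : ℝ) • y := by module
  rw [e1, e2, hc (2 * t) (by linarith [ht.1]) (by linarith [ht.2]), hc 0 le_rfl hδ.le,
    hc t ht.1.le (by linarith [ht.2])]
  have := mul_pos ht.1 hε
  linarith

/-- Points whose slope gaps vanish along a dense set of directions carry a functional that
agrees with the norm on a short segment through the point in each direction. -/
theorem IsPolyhedralSpace.exists_dual_norm_add_smul_eq (hX : IsPolyhedralSpace X) {x : X}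
    {D : Set X} (hD : Dense D) (hx : ∀ y ∈ D, ∀ k : ℕ, x ∈ slopeGapLt y (1 / ((k : ℝ) + 1))) :
    ∃ f : StrongDual ℝ X, ‖f‖ ≤ 1 ∧
      ∀ y, ∃ δ > 0, ∀ t : ℝ, 0 ≤ t → t ≤ δ → ‖x + t • y‖ = f (x + t • y) := by
  obtain ⟨f, hf1, hfx⟩ := exists_dual_vector'' ℝ x
  have hfx : f x = ‖x‖ := hfx
  have hf : ∀ z, f z ≤ ‖z‖ := fun z => (le_abs_self _).trans
    ((f.le_opNorm z).trans (by simpa using mul_le_mul_of_nonneg_right hf1 (norm_nonneg z)))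
  refine ⟨f, hf1, fun y => ?_⟩
  obtain ⟨δ, hδ, c, hc⟩ := hX.exists_norm_add_smul_eq x y
  -- Here `c` is the right slope of the norm at `x`; the opposite inequality follows from `f ≤ ‖·‖`.
  suffices h : c ≤ f y by
    refine ⟨δ, hδ, fun t h0 h1 => le_antisymm ?_ (hf _)⟩
    rw [hc t h0 h1, map_add, map_smul, hfx, smul_eq_mul]
    have := mul_le_mul_of_nonneg_left h h0
    linarith
  refine le_of_forall_pos_le_add fun ε hε => ?_
  obtain ⟨z, hzD, hz⟩ := hD.exists_dist_lt y (show 0 < ε / 4 by linarith)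
  rw [dist_eq_norm] at hz
  obtain ⟨k, hk⟩ := exists_nat_one_div_lt (show 0 < ε / 4 by linarith)
  obtain ⟨t, ht, hlt⟩ := hx z hzD k
  -- The gap controls the sum of the two norms, and `f` bounds the norm at `x - t • z` from below.
  have h1 : ‖x + t • z‖ < ‖x‖ + t * (f z + ε / 4) := by
    have h2 := hf (x - t • z)
    rw [map_sub, map_smul, hfx, smul_eq_mul] at h2
    have := mul_lt_mul_of_pos_left hk ht
    linarith
  -- Convexity carries the estimate from `t` down to `s`, where the affine formula with slope `c` is
  -- also valid.
  obtain ⟨s, hs0, hs⟩ : ∃ s, 0 < s ∧ s ≤ min δ t := ⟨min δ t, lt_min hδ ht, le_rfl⟩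
  have hsδ := hs.trans (min_le_left _ _)
  have hst := hs.trans (min_le_right _ _)
  have h3 : ‖x + s • z‖ ≤ ‖x‖ + s * (f z + ε / 4) := by
    have e : x + s • z = (1 - s / t) • x + (s / t) • (x + t • z) := by
      rw [smul_add, smul_smul, div_mul_cancel₀ _ ht.ne']; module
    have hr : 0 ≤ s / t := by positivity
    have hr1 : s / t ≤ 1 := (div_le_one ht).2 hst
    have h4 := norm_add_le ((1 - s / t) • x) ((s / t) • (x + t • z))
    rw [← e, norm_smul, norm_smul, Real.norm_eq_abs, Real.norm_eq_abs, abs_of_nonneg hr,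
      abs_of_nonneg (by linarith)] at h4
    have h5 := mul_le_mul_of_nonneg_left h1.le hr
    have h6 : s / t * (‖x‖ + t * (f z + ε / 4)) = s / t * ‖x‖ + s * (f z + ε / 4) := by
      field_simp
    linarith
  have h7 : ‖x + s • y‖ ≤ ‖x + s • z‖ + s * ‖y - z‖ := by
    have e : x + s • y = x + s • z + s • (y - z) := by module
    rw [e]
    refine (norm_add_le _ _).trans ?_
    rw [norm_smul, Real.norm_eq_abs, abs_of_pos hs0]
  have h8 : f z ≤ f y + ‖y - z‖ := by
    have := hf (z - y)
    rw [map_sub, norm_sub_rev] at this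
    linarith
  rw [hc s hs0.le hsδ] at h7
  have h9 : s * c ≤ s * (f y + ε) := by
    have h10 : s * c ≤ s * (f z + ε / 4 + ‖y - z‖) := by linarith
    refine h10.trans (mul_le_mul_of_nonneg_left ?_ hs0.le)
    linarith
  exact le_of_mul_le_mul_left h9 hs0

/-- A closed convex set absorbing every direction of a Banach space is a neighborhood of zero. -/
theorem mem_nhds_zero_of_isClosed_convex_absorbing [CompleteSpace X] {C : Set X}
    (hc : IsClosed C) (hconv : Convex ℝ C)
    (habs : ∀ y, ∃ δ > 0, ∀ t : ℝ, 0 ≤ t → t ≤ δ → t • y ∈ C) : C ∈ 𝓝 0 := by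
  -- The dilates of `C` by `n + 1` cover the space, so by Baire one of them has an interior point.
  have hU : ⋃ n : ℕ, (fun y : X => (1 / ((n : ℝ) + 1)) • y) ⁻¹' C = Set.univ := by
    refine Set.eq_univ_of_forall fun y => Set.mem_iUnion.2 ?_
    obtain ⟨δ, hδ, h⟩ := habs y
    obtain ⟨n, hn⟩ := exists_nat_one_div_lt hδ
    exact ⟨n, h _ (by positivity) hn.le⟩
  obtain ⟨n, y, hy⟩ := nonempty_interior_of_iUnion_of_closed
    (fun n : ℕ => hc.preimage (by fun_prop : Continuous fun y : X => (1 / ((n : ℝ) + 1)) • y)) hU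
  rw [mem_interior_iff_mem_nhds] at hy
  obtain ⟨s, hs, h⟩ := habs (-y)
  have hsC := h s hs.le le_rfl
  set r : ℝ := 1 / ((n : ℝ) + 1) with hr
  have hr0 : 0 < r := by positivity
  -- points near zero are convex combinations of points near `r • y` and of `-(s • y)`
  have hcont : Tendsto (fun z : X => y + (((s + r) / s) / r) • z) (𝓝 0) (𝓝 y) := by
    have : Continuous fun z : X => y + (((s + r) / s) / r) • z := by fun_prop
    simpa using this.tendsto 0
  filter_upwards [hcont hy] with z hz
  have hz : r • (y + (((s + r) / s) / r) • z) ∈ C := hz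
  have h1 := hconv hz hsC (show 0 ≤ s / (s + r) by positivity) (show 0 ≤ r / (s + r) by positivity)
    (by field_simp)
  convert h1 using 1
  rw [smul_add, smul_smul, smul_smul, smul_add, smul_smul, smul_smul, smul_neg]
  have e1 : s / (s + r) * (r * ((s + r) / s / r)) = 1 := by field_simp
  have e2 : s / (s + r) * r = r / (s + r) * s := by field_simp
  rw [e1, e2]; module

/-- The points near which the norm coincides with a functional of norm at most one. -/
def locallyLinearNorm (X : Type*) [NormedAddCommGroup X] [NormedSpace ℝ X] : Set X :=
  {x | ∃ f : StrongDual ℝ X, ‖f‖ ≤ 1 ∧ ∀ᶠ z in 𝓝 x, f z = ‖z‖}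

theorem isOpen_locallyLinearNorm : IsOpen (locallyLinearNorm X) := by
  rw [isOpen_iff_eventually]
  rintro x ⟨f, hf, hx⟩
  exact (eventually_eventually_nhds.2 hx).mono fun z hz => ⟨f, hf, hz⟩

/-- By Baire, densely many `x` have vanishing slope gaps along a dense sequence of directions. The
functional obtained there agrees with the norm on a segment in each direction; since agreement is a
closed convex condition, absorption turns these segments into a neighborhood. -/
theorem IsPolyhedralSpace.dense_locallyLinearNorm [CompleteSpace X]
    [TopologicalSpace.SeparableSpace X] (hX : IsPolyhedralSpace X) :
    Dense (locallyLinearNorm X) := by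
  let u := TopologicalSpace.denseSeq X
  have hd : Dense (⋂ p : ℕ × ℕ, slopeGapLt (u p.1) (1 / ((p.2 : ℝ) + 1))) :=
    dense_iInter_of_isOpen (fun p => isOpen_slopeGapLt _ _)
      fun p => hX.dense_slopeGapLt _ (by positivity)
  refine hd.mono fun x hx => ?_
  rw [Set.mem_iInter] at hx
  obtain ⟨f, hf, h⟩ := hX.exists_dual_norm_add_smul_eq (TopologicalSpace.denseRange_denseSeq X)
    (by rintro _ ⟨j, rfl⟩ k; exact hx (j, k))
  refine ⟨f, hf, ?_⟩
  have hfle : ∀ z, f z ≤ ‖z‖ := fun z => (le_abs_self _).trans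
    ((f.le_opNorm z).trans (by simpa using mul_le_mul_of_nonneg_right hf (norm_nonneg z)))
  have hC : {y : X | ‖x + y‖ ≤ f (x + y)} ∈ 𝓝 (0 : X) := by
    refine mem_nhds_zero_of_isClosed_convex_absorbing
      (isClosed_le (by fun_prop) (by fun_prop)) ?_ fun y => ?_
    · intro y hy z hz a b ha hb hab
      have hy : ‖x + y‖ ≤ f (x + y) := hy
      have hz : ‖x + z‖ ≤ f (x + z) := hz
      have e : x + (a • y + b • z) = a • (x + y) + b • (x + z) := by
        calc x + (a • y + b • z) = (a + b) • x + (a • y + b • z) := by rw [hab, one_smul]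
          _ = _ := by module
      change ‖x + (a • y + b • z)‖ ≤ f (x + (a • y + b • z))
      rw [e, map_add, map_smul, map_smul, smul_eq_mul, smul_eq_mul]
      refine (norm_add_le _ _).trans ?_
      rw [norm_smul, norm_smul, Real.norm_eq_abs, Real.norm_eq_abs, abs_of_nonneg ha,
        abs_of_nonneg hb]
      gcongr
    · obtain ⟨δ, hδ, h'⟩ := h y
      exact ⟨δ, hδ, fun t h0 h1 => (h' t h0 h1).le⟩
  have ht : Tendsto (fun z : X => z - x) (𝓝 x) (𝓝 0) := by
    have : Continuous fun z : X => z - x := by fun_prop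
    simpa using this.tendsto x
  filter_upwards [ht hC] with z hz
  have hz : ‖x + (z - x)‖ ≤ f (x + (z - x)) := hz
  rw [add_sub_cancel] at hz
  exact le_antisymm (hfle z) hz

/-- The functionals of norm at most one that agree with the norm on some nonempty open set. -/
def openFaceFunctionals (X : Type*) [NormedAddCommGroup X] [NormedSpace ℝ X] :
    Set (StrongDual ℝ X) :=
  {f | ‖f‖ ≤ 1 ∧ (interior {z | f z = ‖z‖}).Nonempty}

theorem ContinuousLinearMap.eq_of_eventuallyEq {f g : StrongDual ℝ X} {x : X}
    (h : ∀ᶠ z in 𝓝 x, f z = g z) : f = g := by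
  ext y
  have ht : Tendsto (fun t : ℝ => x + t • y) (𝓝[>] 0) (𝓝 x) := by
    have : Continuous fun t : ℝ => x + t • y := by fun_prop
    simpa using (this.tendsto 0).mono_left nhdsWithin_le_nhds
  obtain ⟨t, h1, h2⟩ := ((ht.eventually h).and eventually_mem_nhdsWithin).exists
  have h0 := h.self_of_nhds
  simp only [map_add, map_smul, h0, smul_eq_mul, add_right_inj] at h1
  exact mul_left_cancel₀ (ne_of_gt h2) h1

/-- Functionals agreeing on a nonempty open set are equal, so distinct ones have disjoint open
faces. -/
theorem countable_openFaceFunctionals [TopologicalSpace.SeparableSpace X] :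
    (openFaceFunctionals X).Countable := by
  refine Set.PairwiseDisjoint.countable_of_isOpen (s := fun f : StrongDual ℝ X =>
    interior {z | f z = ‖z‖}) ?_ (fun f _ => isOpen_interior) fun f hf => hf.2
  intro f _ g _ hfg
  rw [Function.onFun, Set.disjoint_left]
  intro x hxf hxg
  rw [mem_interior_iff_mem_nhds] at hxf hxg
  refine hfg (ContinuousLinearMap.eq_of_eventuallyEq (x := x) ?_)
  filter_upwards [hxf, hxg] with z h1 h2
  exact h1.trans h2.symm

/-- A separable polyhedral Banach space has a countable boundary. -/
theorem IsPolyhedralSpace.exists_countable_boundary [CompleteSpace X]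
    [TopologicalSpace.SeparableSpace X] (hX : IsPolyhedralSpace X) :
    ∃ f : ℕ → StrongDual ℝ X, (∀ n, ‖f n‖ ≤ 1) ∧ ∀ x, ∃ n, f n x = ‖x‖ := by
  have key : ∀ x : X, ∃ f ∈ openFaceFunctionals X, f x = ‖x‖ := by
    intro x
    -- The length `δ` is known only once `y` is chosen, so `y` must serve all the scales `1 / (n +
    -- 1)` at once.
    have hd : Dense (⋂ n : ℕ, (fun y : X => x + (1 / ((n : ℝ) + 1)) • y) ⁻¹'
        locallyLinearNorm X) := by
      refine dense_iInter_of_isOpen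
        (fun n => isOpen_locallyLinearNorm.preimage (by fun_prop)) fun n => ?_
      have hn : (1 / ((n : ℝ) + 1)) ≠ 0 := by positivity
      exact hX.dense_locallyLinearNorm.preimage
        (((Homeomorph.smulOfNeZero _ hn).trans (Homeomorph.addLeft x)).isOpenMap)
    obtain ⟨y, hy⟩ := hd.nonempty
    rw [Set.mem_iInter] at hy
    obtain ⟨δ, hδ, c, hc⟩ := hX.exists_norm_add_smul_eq x y
    obtain ⟨n, hn⟩ := exists_nat_one_div_lt hδ
    obtain ⟨f, hf, hev⟩ := hy n
    set r : ℝ := 1 / ((n : ℝ) + 1)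
    have hr : 0 < r := by positivity
    refine ⟨f, ⟨hf, x + r • y, mem_interior_iff_mem_nhds.2 hev⟩, ?_⟩
    have ht : Tendsto (fun t : ℝ => x + t • y) (𝓝[>] r) (𝓝 (x + r • y)) := by
      have : Continuous fun t : ℝ => x + t • y := by fun_prop
      simpa using (this.tendsto r).mono_left nhdsWithin_le_nhds
    -- Along the ray both `f` and the norm are affine and agree at the two parameters `r < t`, hence
    -- also at zero.
    obtain ⟨t, h1, h2⟩ := ((ht.eventually hev).and (Ioo_mem_nhdsGT hn)).exists
    have h0 := hev.self_of_nhds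
    rw [hc r hr.le hn.le, map_add, map_smul, smul_eq_mul] at h0
    rw [hc t (hr.trans h2.1).le h2.2.le, map_add, map_smul, smul_eq_mul] at h1
    have h3 : (t - r) * (f y - c) = 0 := by linarith
    have h4 : f y - c = 0 :=
      (mul_eq_zero.1 h3).resolve_left (sub_pos.2 h2.1).ne'
    have h5 : f y = c := by linarith
    rw [h5] at h0
    linarith
  have hne : (openFaceFunctionals X).Nonempty := by obtain ⟨f, hf, -⟩ := key 0; exact ⟨f, hf⟩
  obtain ⟨f, hf⟩ := countable_openFaceFunctionals.exists_eq_range hne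
  refine ⟨f, fun n => ?_, fun x => ?_⟩
  · have : f n ∈ openFaceFunctionals X := hf ▸ Set.mem_range_self n
    exact this.1
  · obtain ⟨g, hg, hgx⟩ := key x
    rw [hf] at hg
    obtain ⟨n, rfl⟩ := hg
    exact ⟨n, hgx⟩

end Polyhedral

/-! ### Ekeland's variational principle -/

section Ekeland

/-- Ekeland's variational principle for a linear functional on a bounded closed set. -/
theorem exists_le_add_mul_norm_sub {X : Type*} [NormedAddCommGroup X] [NormedSpace ℝ X]
    [CompleteSpace X] {C : Set X} (hC : IsClosed C) (hne : C.Nonempty)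
    (f : StrongDual ℝ X) (hb : BddAbove (f '' C)) {ε : ℝ} (hε : 0 < ε) :
    ∃ x ∈ C, ∀ y ∈ C, f y ≤ f x + ε * ‖y - x‖ := by
  -- the points of `C` above `x` in the Ekeland order
  let S : X → Set X := fun x => {y | y ∈ C ∧ f x + ε * ‖y - x‖ ≤ f y}
  have hSne : ∀ x ∈ C, (f '' S x).Nonempty := fun x hx => ⟨f x, x, ⟨hx, by simp⟩, rfl⟩
  have hSb : ∀ x, BddAbove (f '' S x) := fun x =>
    hb.mono (Set.image_mono fun y hy => hy.1)
  have hStrans : ∀ x y z, y ∈ S x → z ∈ S y → z ∈ S x := by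
    rintro x y z ⟨_, h1⟩ ⟨hz, h2⟩
    refine ⟨hz, ?_⟩
    have := mul_le_mul_of_nonneg_left (norm_sub_le_norm_sub_add_norm_sub z y x) hε.le
    linarith
  -- Nearly maximizing `f` on `S x` forces the next set `S y` into a ball of radius `(1 / 2) ^ n /
  -- ε` around `y`.
  have hstep : ∀ (x : ↥C) (n : ℕ), ∃ y : C, (y : X) ∈ S x ∧
      sSup (f '' S x) - (1 / 2) ^ n < f y := by
    intro x n
    obtain ⟨_, ⟨y, hy, rfl⟩, h⟩ := exists_lt_of_lt_csSup (hSne x x.2)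
      (show sSup (f '' S x) - (1 / 2) ^ n < sSup (f '' S x) by
        have : (0 : ℝ) < (1 / 2) ^ n := by positivity
        linarith)
    exact ⟨⟨y, hy.1⟩, hy, h⟩
  choose g hgS hgsup using hstep
  obtain ⟨x₀, hx₀⟩ := hne
  let u : ℕ → ↥C := fun n => Nat.rec ⟨x₀, hx₀⟩ (fun n x => g x n) n
  have hu : ∀ n : ℕ, (u (n + 1) : X) = g (u n) n := fun n => rfl
  have humem : ∀ m n : ℕ, m ≤ n → (u n).1 ∈ S (u m).1 := by
    intro m n h
    induction n, h using Nat.le_induction with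
    | base => exact ⟨(u m).2, by simp⟩
    | succ n _ ih => exact hStrans _ _ _ ih (hu n ▸ hgS (u n) n)
  have hclose : ∀ (n : ℕ) (y : X), y ∈ S (u (n + 1)).1 → ε * ‖y - (u (n + 1)).1‖ ≤ (1 / 2) ^ n := by
    intro n y hy
    have h1 : f y ≤ sSup (f '' S (u n).1) :=
      le_csSup (hSb (u n).1) ⟨y, hStrans (u n).1 (u (n + 1)).1 y (humem n (n + 1) n.le_succ) hy, rfl⟩
    have h2 := hgsup (u n) n
    rw [← hu n] at h2
    linarith [hy.2]
  have hcauchy : CauchySeq fun n => (u (n + 1) : X) := by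
    refine cauchySeq_of_le_tendsto_0' (fun n : ℕ => (1 / ε) * (1 / 2 : ℝ) ^ n) ?_ ?_
    · intro n m hnm
      have := hclose n _ (humem (n + 1) (m + 1) (by omega))
      rw [dist_comm, dist_eq_norm, one_div_mul_eq_div, le_div_iff₀ hε]
      linarith
    · have := (tendsto_pow_atTop_nhds_zero_of_lt_one (show (0 : ℝ) ≤ 1 / 2 by norm_num)
        (by norm_num)).const_mul (1 / ε)
      simpa using this
  obtain ⟨x, hx⟩ := cauchySeq_tendsto_of_complete hcauchy
  have hSclosed : ∀ z, IsClosed (S z) := fun z =>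
    hC.inter (isClosed_le (f := fun y : X => f z + ε * ‖y - z‖) (g := fun y => f y)
      (by fun_prop) (by fun_prop))
  have hxS : ∀ n : ℕ, x ∈ S (u (n + 1)).1 := fun n =>
    (hSclosed _).mem_of_tendsto hx ((eventually_ge_atTop n).mono fun m hm =>
      humem (n + 1) (m + 1) (by omega))
  refine ⟨x, (hxS 0).1, fun y hy => ?_⟩
  by_contra! hlt
  -- A point violating the conclusion lies in all the shrinking sets, so it must be the limit `x`
  -- itself.
  have hyS : ∀ n : ℕ, y ∈ S (u (n + 1)).1 := fun n => hStrans _ _ _ (hxS n) ⟨hy, hlt.le⟩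
  have hy' : Tendsto (fun n => (u (n + 1) : X)) atTop (𝓝 y) := by
    rw [tendsto_iff_norm_sub_tendsto_zero]
    refine squeeze_zero (fun _ => norm_nonneg _)
      (g := fun n : ℕ => (1 / ε) * (1 / 2 : ℝ) ^ n) (fun n => ?_) ?_
    · rw [norm_sub_rev, one_div_mul_eq_div, le_div_iff₀ hε]
      linarith [hclose n y (hyS n)]
    · have := (tendsto_pow_atTop_nhds_zero_of_lt_one (show (0 : ℝ) ≤ 1 / 2 by norm_num)
        (by norm_num)).const_mul (1 / ε)
      simpa using this
  obtain rfl := tendsto_nhds_unique hx hy'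
  simp at hlt

end Ekeland

/-! ### A countable boundary makes the dual separable -/

section Boundary

variable {X : Type*} [NormedAddCommGroup X] [NormedSpace ℝ X]

/-- A functional that is small on the common kernel of finitely many functionals is close to
their span. -/
theorem exists_mem_span_norm_sub_le (s : Finset (StrongDual ℝ X)) (f : StrongDual ℝ X) {ε : ℝ}
    (hε : 0 ≤ ε) (h : ∀ y, (∀ g ∈ s, g y = 0) → |f y| ≤ ε * ‖y‖) :
    ∃ g ∈ Submodule.span ℝ (s : Set (StrongDual ℝ X)), ‖f - g‖ ≤ ε := by
  let K : Submodule ℝ X := ⨅ g : s, (g : StrongDual ℝ X).toLinearMap.ker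
  have hK : ∀ y, y ∈ K ↔ ∀ g ∈ s, g y = 0 := fun y => by simp [K, Submodule.mem_iInf]
  -- Hahn–Banach: extending `f` from `K` without increasing its norm leaves a difference that
  -- vanishes on `K`.
  obtain ⟨k, hk, hkn⟩ := exists_extension_norm_eq K (f.comp K.subtypeL)
  have hkn' : ‖k‖ ≤ ε := by
    rw [hkn]
    exact ContinuousLinearMap.opNorm_le_bound _ hε fun y => h y ((hK y).1 y.2)
  refine ⟨f - k, ?_, by simpa using hkn'⟩
  have hker : (⨅ g : s, (g : StrongDual ℝ X).toLinearMap.ker) ≤ (f - k).toLinearMap.ker := by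
    intro y hy
    have := hk ⟨y, hy⟩
    simp at this ⊢
    linarith
  have hmem := mem_span_of_iInf_ker_le_ker hker
  rw [Submodule.mem_span_range_iff_exists_fun] at hmem
  obtain ⟨c, hc⟩ := hmem
  have : f - k = ∑ i : s, c i • (i : StrongDual ℝ X) := by
    ext y
    have := LinearMap.congr_fun hc y
    simpa using this.symm
  rw [this]
  exact Submodule.sum_mem _ fun i _ => Submodule.smul_mem _ _ (Submodule.subset_span i.2)

/-- The span of a countable boundary is dense in the dual. -/
theorem dense_span_range_of_boundary [CompleteSpace X] {f : ℕ → StrongDual ℝ X}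
    (hf : ∀ n, ‖f n‖ ≤ 1) (hbd : ∀ x, ∃ n, f n x = ‖x‖) :
    Dense (Submodule.span ℝ (Set.range f) : Set (StrongDual ℝ X)) := by
  have hle : ∀ n z, |f n z| ≤ ‖z‖ := fun n z =>
    ((f n).le_opNorm z).trans (by simpa using mul_le_mul_of_nonneg_right (hf n) (norm_nonneg z))
  -- With strictly decreasing weights, if `x ∈ C` and `f N x = ‖x‖`, all constraints beyond `N` are
  -- uniformly slack at `x`.
  let w : ℕ → ℝ := fun n => 1 + (1 / 2) ^ n
  have hw1 : ∀ n, 1 < w n := fun n => lt_add_of_pos_right _ (by positivity)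
  have hw2 : ∀ n, w n ≤ 2 := fun n => by
    have : (1 / 2 : ℝ) ^ n ≤ 1 := pow_le_one₀ (by norm_num) (by norm_num)
    change 1 + (1 / 2 : ℝ) ^ n ≤ 2
    linarith
  have hwanti : ∀ m n, m < n → w n ≤ w (m + 1) := fun m n h => by
    have : (1 / 2 : ℝ) ^ n ≤ (1 / 2) ^ (m + 1) :=
      pow_le_pow_of_le_one (by norm_num) (by norm_num) h
    change 1 + (1 / 2 : ℝ) ^ n ≤ 1 + (1 / 2) ^ (m + 1)
    linarith
  have hwlt : ∀ m, w (m + 1) < w m := fun m => by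
    have : (0 : ℝ) < (1 / 2) ^ m := by positivity
    change 1 + (1 / 2 : ℝ) ^ (m + 1) < 1 + (1 / 2) ^ m
    rw [pow_succ]; linarith
  let C : Set X := {x | ∀ n, w n * |f n x| ≤ 1}
  have hCcl : IsClosed C := by
    have : C = ⋂ n, {x | w n * |f n x| ≤ 1} := by ext; simp [C]
    rw [this]
    exact isClosed_iInter fun n => isClosed_le (by fun_prop) (by fun_prop)
  have hCnorm : ∀ x ∈ C, ∀ n, f n x = ‖x‖ → w n * ‖x‖ ≤ 1 := fun x hx n hn => by
    have := hx n
    rwa [hn, abs_of_nonneg (norm_nonneg x)] at this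
  have hCb : ∀ x ∈ C, ‖x‖ ≤ 1 := fun x hx => by
    obtain ⟨n, hn⟩ := hbd x
    have h1 := hCnorm x hx n hn
    have := mul_le_mul_of_nonneg_right (hw1 n).le (norm_nonneg x)
    linarith
  intro φ
  rw [Metric.mem_closure_iff]
  intro ε hε
  obtain ⟨x, hxC, hx⟩ := exists_le_add_mul_norm_sub hCcl ⟨0, fun n => by simp⟩ φ
    ⟨‖φ‖, by
      rintro _ ⟨y, hy, rfl⟩
      refine (le_abs_self _).trans ((φ.le_opNorm y).trans ?_)
      simpa using mul_le_mul_of_nonneg_left (hCb y hy) (norm_nonneg φ)⟩ (half_pos hε)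
  obtain ⟨N, hN⟩ := hbd x
  have hxlt : w (N + 1) * ‖x‖ < 1 := by
    rcases (norm_nonneg x).eq_or_lt with h0 | h0
    · rw [← h0]; norm_num
    · exact (mul_lt_mul_of_pos_right (hwlt N) h0).trans_le (hCnorm x hxC N hN)
  -- small perturbations of `x` in the common kernel of `f 0, …, f N` stay in `C`
  have hpert : ∃ η > 0, ∀ y, (∀ i ≤ N, f i y = 0) → ‖y‖ ≤ η → x + y ∈ C := by
    -- Half the slack suffices because the weights are at most two.
    refine ⟨(1 - w (N + 1) * ‖x‖) / 2, by linarith, fun y hy hyη n => ?_⟩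
    rcases le_or_gt n N with h | h
    · rw [map_add, hy n h, add_zero]; exact hxC n
    · have h1 : |f n (x + y)| ≤ ‖x‖ + ‖y‖ := (hle n _).trans (norm_add_le _ _)
      calc w n * |f n (x + y)| ≤ w (N + 1) * (‖x‖ + ‖y‖) :=
            mul_le_mul (hwanti N n h) h1 (abs_nonneg _) (by linarith [hw1 (N + 1)])
        _ ≤ w (N + 1) * ‖x‖ + 2 * ‖y‖ := by
            rw [mul_add]
            exact add_le_add_right (mul_le_mul_of_nonneg_right (hw2 _) (norm_nonneg _)) _
        _ ≤ 1 := by linarith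
  obtain ⟨η, hη, hpert⟩ := hpert
  have hsmall : ∀ y, (∀ i ≤ N, f i y = 0) → φ y ≤ ε / 2 * ‖y‖ := by
    intro y hy
    rcases eq_or_ne y 0 with rfl | hy0
    · simp
    have hy0' := norm_pos_iff.2 hy0
    have hr : 0 < η / ‖y‖ := by positivity
    have hn : ‖(η / ‖y‖) • y‖ = η := by
      rw [norm_smul, Real.norm_eq_abs, abs_of_pos hr, div_mul_cancel₀ _ hy0'.ne']
    have := hx _ (hpert ((η / ‖y‖) • y) (fun i hi => by rw [map_smul, hy i hi, smul_zero]) hn.le)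
    rw [add_sub_cancel_left, map_add, map_smul, norm_smul, Real.norm_eq_abs, abs_of_pos hr,
      smul_eq_mul] at this
    have h2 : η / ‖y‖ * φ y ≤ η / ‖y‖ * (ε / 2 * ‖y‖) := by linarith
    exact le_of_mul_le_mul_left h2 hr
  classical
  obtain ⟨g, hg, hgn⟩ := exists_mem_span_norm_sub_le ((Finset.range (N + 1)).image f) φ
    (half_pos hε).le fun y hy => by
      have hy' : ∀ i ≤ N, f i y = 0 := fun i hi =>
        hy _ (Finset.mem_image_of_mem _ (by simpa [Nat.lt_succ_iff] using hi))
      rw [abs_le']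
      refine ⟨hsmall y hy', ?_⟩
      have := hsmall (-y) fun i hi => by rw [map_neg, hy' i hi, neg_zero]
      rwa [map_neg, norm_neg] at this
  refine ⟨g, Submodule.span_mono ?_ hg, ?_⟩
  · simp
  · rw [dist_eq_norm]; linarith

/-- A Banach space with a countable boundary has separable dual. -/
theorem separableSpace_dual_of_boundary [CompleteSpace X] {f : ℕ → StrongDual ℝ X}
    (hf : ∀ n, ‖f n‖ ≤ 1) (hbd : ∀ x, ∃ n, f n x = ‖x‖) :
    TopologicalSpace.SeparableSpace (StrongDual ℝ X) := by
  have h := (Set.countable_range f).isSeparable.span (R := ℝ)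
  have h2 := h.closure
  rw [(dense_span_range_of_boundary hf hbd).closure_eq] at h2
  exact TopologicalSpace.isSeparable_univ_iff.1 h2

end Boundary

/-! ### Density of the coordinate functionals in the dual -/

section Coordinates

variable {E : Type*} [NormedAddCommGroup E] [NormedSpace ℝ E]

theorem SchauderBasis.comp_proj_mem_span (b : SchauderBasis ℝ E) (f : StrongDual ℝ E) (k : ℕ) :
    f.comp (SchauderBasis.proj b k) ∈ Submodule.span ℝ (Set.range b.coord) := by
  have : f.comp (SchauderBasis.proj b k) = ∑ i ∈ Finset.range k, f (b i) • b.coord i := by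
    ext x
    simp [mul_comm]
  rw [this]
  exact Submodule.sum_mem _ fun i _ => Submodule.smul_mem _ _ (Submodule.subset_span ⟨i, rfl⟩)

/-- A functional outside the closed span of the coordinates is large on blocks arbitrarily far
out. -/
theorem SchauderBasis.exists_block [CompleteSpace E] (b : SchauderBasis ℝ E)
    {f : StrongDual ℝ E}
    (hf : f ∉ closure (Submodule.span ℝ (Set.range b.coord) : Set (StrongDual ℝ E))) :
    ∃ c > 0, ∀ k : ℕ, ∃ m > k, ∃ y ∈ Submodule.span ℝ (b '' Set.Ico k m), c * ‖y‖ < |f y| := by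
  rw [Metric.mem_closure_iff] at hf
  push Not at hf
  obtain ⟨δ, hδ, hf⟩ := hf
  obtain ⟨M, hM⟩ := SchauderBasis.exists_norm_proj_le b
  have hM0 : 0 ≤ M := (norm_nonneg _).trans (hM 0)
  -- The remainder `f - f ∘ P k` has norm at least `δ`; a factor 2 is lost in choosing `x`, and `2 *
  -- (M + 1)` in passing to the block `P m x - P k x`.
  refine ⟨δ / (4 * (M + 1)), by positivity, fun k => ?_⟩
  have hk := hf _ (SchauderBasis.comp_proj_mem_span b f k)
  rw [dist_eq_norm] at hk
  obtain ⟨x, hx⟩ : ∃ x, δ / 2 * ‖x‖ < |(f - f.comp (SchauderBasis.proj b k)) x| := by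
    by_contra! h
    have := (f - f.comp (SchauderBasis.proj b k)).opNorm_le_bound (half_pos hδ).le h
    linarith
  have ht : Tendsto (fun m => |f (SchauderBasis.proj b m x - SchauderBasis.proj b k x)|) atTop
      (𝓝 |f (x - SchauderBasis.proj b k x)|) :=
    ((f.continuous.tendsto _).comp
      ((SchauderBasis.tendsto_proj b x).sub_const (SchauderBasis.proj b k x))).abs
  have hx' : δ / 2 * ‖x‖ < |f (x - SchauderBasis.proj b k x)| := by
    simpa only [sub_apply, ContinuousLinearMap.comp_apply, map_sub] using hx
  obtain ⟨m, hm, hkm⟩ := ((ht.eventually_const_lt hx').and (eventually_gt_atTop k)).exists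
  refine ⟨m, hkm, SchauderBasis.proj b m x - SchauderBasis.proj b k x, ?_, ?_⟩
  · rw [SchauderBasis.proj_apply, SchauderBasis.proj_apply, ← Finset.sum_Ico_eq_sub _ hkm.le]
    exact Submodule.sum_mem _ fun i hi => Submodule.smul_mem _ _
      (Submodule.subset_span ⟨i, by simpa using hi, rfl⟩)
  · refine lt_of_le_of_lt ?_ hm
    have h1 : ‖SchauderBasis.proj b m x - SchauderBasis.proj b k x‖ ≤ 2 * (M + 1) * ‖x‖ := by
      have e1 := (SchauderBasis.proj b m).le_of_opNorm_le (hM m) x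
      have e2 := (SchauderBasis.proj b k).le_of_opNorm_le (hM k) x
      have := norm_sub_le (SchauderBasis.proj b m x) (SchauderBasis.proj b k x)
      have := norm_nonneg x
      linarith
    calc _ ≤ δ / (4 * (M + 1)) * (2 * (M + 1) * ‖x‖) := by gcongr
      _ = δ / 2 * ‖x‖ := by field_simp; ring

/-- For an unconditional basis, a functional can be restricted to any set of coordinates. -/
theorem IsUnconditionalBasis.exists_restrict [CompleteSpace E] {b : SchauderBasis ℝ E}
    (hb : IsUnconditionalBasis b) (f : StrongDual ℝ E) (T : Set ℕ) :
    ∃ g : StrongDual ℝ E, (∀ i ∈ T, g (b i) = f (b i)) ∧ ∀ i ∉ T, g (b i) = 0 := by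
  classical
  -- Unconditional convergence permits dropping terms; Banach–Steinhaus later makes the limit
  -- continuous.
  have hs : ∀ x, Summable (T.indicator fun i => f (b.coord i x • b i)) := fun x =>
    ((hb x).mapL f).summable.indicator T
  let G : ℕ → StrongDual ℝ E := fun n =>
    ∑ i ∈ Finset.range n, if i ∈ T then f (b i) • b.coord i else 0
  have hG : ∀ n x, G n x = ∑ i ∈ Finset.range n, T.indicator (fun i => f (b.coord i x • b i)) i := by
    intro n x
    simp only [G, sum_apply]
    refine Finset.sum_congr rfl fun i _ => ?_
    by_cases hi : i ∈ T <;> simp [hi, mul_comm]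
  have ht : Tendsto (fun n x => G n x) atTop
      (𝓝 fun x => ∑' i, T.indicator (fun i => f (b.coord i x • b i)) i) := by
    rw [tendsto_pi_nhds]
    intro x
    simp only [hG]
    exact (hs x).hasSum.tendsto_sum_nat
  have hval : ∀ i, (∑' j, T.indicator (fun j => f (b.coord j (b i) • b j)) j) =
      T.indicator (fun i => f (b i)) i := by
    intro i
    rw [tsum_eq_single i]
    · by_cases hi : i ∈ T <;> simp [hi, b.ortho]
    · intro j hj
      by_cases hjT : j ∈ T <;> simp [hjT, b.ortho, hj]
  refine ⟨continuousLinearMapOfTendsto G ht, fun i hi => ?_, fun i hi => ?_⟩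
  · exact (hval i).trans (by simp [hi])
  · exact (hval i).trans (by simp [hi])

/-- In a Banach space with separable dual, the coordinates of an unconditional basis span a dense
subspace of the dual. -/
theorem IsUnconditionalBasis.dense_span_coord [CompleteSpace E] {b : SchauderBasis ℝ E}
    (hb : IsUnconditionalBasis b) [TopologicalSpace.SeparableSpace (StrongDual ℝ E)] :
    Dense (Submodule.span ℝ (Set.range b.coord) : Set (StrongDual ℝ E)) := by
  intro f
  by_contra hf
  obtain ⟨c, hc, hblock⟩ := SchauderBasis.exists_block b hf
  choose m hm y hy hyf using hblock
  obtain ⟨k, hk⟩ : ∃ k : ℕ → ℕ, ∀ j, k (j + 1) = m (k j) :=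
    ⟨fun j => Nat.rec 0 (fun _ i => m i) j, fun _ => rfl⟩
  have hmono : StrictMono k := strictMono_nat_of_lt_succ fun j => hk j ▸ hm (k j)
  have hdisj : ∀ i j, ∀ l ∈ Set.Ico (k i) (k (i + 1)), l ∈ Set.Ico (k j) (k (j + 1)) → i = j := by
    intro i j l hi hj
    have h1 := hmono.lt_iff_lt.1 (hi.1.trans_lt hj.2)
    have h2 := hmono.lt_iff_lt.1 (hj.1.trans_lt hi.2)
    omega
  -- Each set `A` of blocks gives the restriction of `f` to `A`. Two sets differ in some block,
  -- where the restrictions differ by more than `c`, so separability contradicts the uncountability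
  -- of `Set ℕ`.
  choose g hg1 hg0 using fun A : Set ℕ =>
    hb.exists_restrict f (⋃ j ∈ A, Set.Ico (k j) (k (j + 1)))
  have hin : ∀ A : Set ℕ, ∀ j ∈ A, g A (y (k j)) = f (y (k j)) := by
    intro A j hj
    refine LinearMap.eqOn_span (f := (g A).toLinearMap) (g := f.toLinearMap) ?_ (hy (k j))
    rintro _ ⟨i, hi, rfl⟩
    exact hg1 A i (Set.mem_biUnion hj ((hk j).symm ▸ hi))
  have hout : ∀ A : Set ℕ, ∀ j ∉ A, g A (y (k j)) = 0 := by
    intro A j hj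
    refine LinearMap.eqOn_span (f := (g A).toLinearMap) (g := 0) ?_ (hy (k j))
    rintro _ ⟨i, hi, rfl⟩
    refine hg0 A i fun hmem => ?_
    obtain ⟨l, hl, hil⟩ := Set.mem_iUnion₂.1 hmem
    exact hj (hdisj j l i ((hk j).symm ▸ hi) hil ▸ hl)
  have hsep' : ∀ A B : Set ℕ, ∀ j ∈ A, j ∉ B → c < ‖g A - g B‖ := by
    intro A B j hA hB
    by_contra! h
    have h1 := (g A - g B).le_of_opNorm_le h (y (k j))
    rw [sub_apply, hin A j hA, hout B j hB, sub_zero, Real.norm_eq_abs] at h1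
    exact absurd (hyf (k j)) h1.not_gt
  have hsep : ∀ A B : Set ℕ, A ≠ B → c < ‖g A - g B‖ := by
    intro A B hAB
    obtain ⟨j, hj⟩ : ∃ j, ¬(j ∈ A ↔ j ∈ B) := by
      by_contra! h
      exact hAB (Set.ext h)
    by_cases hA : j ∈ A
    · exact hsep' A B j hA fun hB => hj ⟨fun _ => hB, fun _ => hA⟩
    · rw [norm_sub_rev]
      refine hsep' B A j ?_ hA
      by_contra hB
      exact hj ⟨fun h => absurd h hA, fun h => absurd h hB⟩
  have hcount : Countable (Set ℕ) := by
    refine Pairwise.countable_of_isOpen_disjoint (s := fun A : Set ℕ => Metric.ball (g A) (c / 2))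
      (fun A B hAB => Metric.ball_disjoint_ball ?_) (fun A => Metric.isOpen_ball)
      fun A => Metric.nonempty_ball.2 (half_pos hc)
    rw [dist_eq_norm]
    linarith [hsep A B hAB]
  obtain ⟨φ, hφ⟩ := exists_surjective_nat (Set ℕ)
  exact Function.cantor_surjective φ hφ

/-- The coordinates of a shrinking basis span a dense subspace of the dual. -/
theorem IsShrinkingBasis.dense_span_coord {b : SchauderBasis ℝ E} (hb : IsShrinkingBasis b) :
    Dense (Submodule.span ℝ (Set.range b.coord) : Set (StrongDual ℝ E)) := by
  obtain ⟨B, hB⟩ := hb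
  intro f
  refine mem_closure_of_tendsto (SchauderBasis.tendsto_proj B f) (Eventually.of_forall fun n => ?_)
  rw [SchauderBasis.proj_apply]
  exact Submodule.sum_mem _ fun i _ => Submodule.smul_mem _ _
    (Submodule.subset_span ⟨i, (hB i).symm⟩)

/-- A space with a Schauder basis is separable. -/
theorem SchauderBasis.separableSpace (b : SchauderBasis ℝ E) :
    TopologicalSpace.SeparableSpace E := by
  have h := ((Set.countable_range b.basis).isSeparable.span (R := ℝ)).closure
  refine TopologicalSpace.isSeparable_univ_iff.1 (h.mono fun x _ => ?_)
  refine mem_closure_of_tendsto (SchauderBasis.tendsto_proj b x) (Eventually.of_forall fun n => ?_)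
  rw [SchauderBasis.proj_apply]
  exact Submodule.sum_mem _ fun i _ => Submodule.smul_mem _ _ (Submodule.subset_span ⟨i, rfl⟩)

end Coordinates

/-! ### From a countable boundary to a monotone attaining norm -/

section SupSeminorm

variable {E : Type*} [NormedAddCommGroup E] [NormedSpace ℝ E]

/-- The pointwise supremum of the absolute values of a bounded family of functionals. -/
theorem exists_seminorm_eq_iSup {ι : Type*} [Nonempty ι] (φ : ι → StrongDual ℝ E) {M : ℝ}
    (hM : ∀ i, ‖φ i‖ ≤ M) :
    ∃ p : Seminorm ℝ E, (∀ i x, |φ i x| ≤ p x) ∧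
      ∀ x r, (∀ i, |φ i x| ≤ r) → p x ≤ r := by
  have hb : BddAbove (Set.range fun i => (φ i).toLinearMap.toSeminorm) := by
    rw [Seminorm.bddAbove_range_iff]
    rintro x
    refine ⟨M * ‖x‖, ?_⟩
    rintro _ ⟨i, rfl⟩
    exact (φ i).le_of_opNorm_le (hM i) x
  refine ⟨⨆ i, (φ i).toLinearMap.toSeminorm, fun i x => ?_, fun x r h => ?_⟩
  · rw [Seminorm.iSup_apply hb]
    exact le_ciSup (Seminorm.bddAbove_range_iff.1 hb x) i
  · rw [Seminorm.iSup_apply hb]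
    exact ciSup_le h

/-- A convergent real sequence whose limit is at most one of its terms attains its supremum. -/
theorem exists_forall_le_of_tendsto {u : ℕ → ℝ} {l : ℝ} (h : Tendsto u atTop (𝓝 l)) {K : ℕ}
    (hK : l ≤ u K) : ∃ m, ∀ k, u k ≤ u m := by
  by_cases hex : ∃ j, l < u j
  · obtain ⟨j, hj⟩ := hex
    obtain ⟨N, hN⟩ := eventually_atTop.1 (h.eventually_lt_const hj)
    obtain ⟨m, hm, hmax⟩ := (Finset.range (max N j + 1)).exists_max_image u ⟨0, by simp⟩
    refine ⟨m, fun k => ?_⟩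
    rcases le_or_gt N k with hk | hk
    · exact (hN k hk).le.trans (hmax j (by simp))
    · exact hmax k (by simp [hk.le])
  · push Not at hex
    exact ⟨K, fun k => (hex k).trans hK⟩

/-- Functionals close to slightly inflated boundary functionals attain their supremum at every
point, and the supremum dominates the original seminorm. -/
theorem exists_forall_abs_le_of_close {f g : ℕ → StrongDual ℝ E} {q : Seminorm ℝ E} {c : ℝ}
    (hq : ∀ x, c * ‖x‖ ≤ q x) (hf : ∀ n x, |f n x| ≤ q x)
    (hbd : ∀ x, ∃ n, f n x = q x)
    (hg : ∀ n, ‖g n - (1 + (1 / 2 : ℝ) ^ n) • f n‖ ≤ c / 4 * (1 / 2) ^ n) (x : E) :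
    ∃ n, q x ≤ |g n x| ∧ ∀ m, |g m x| ≤ |g n x| := by
  have hq0 : 0 ≤ q x := apply_nonneg q x
  have herr : ∀ n, |g n x - (1 + (1 / 2 : ℝ) ^ n) * f n x| ≤ (1 / 2) ^ n / 4 * q x := by
    intro n
    have h1 := (g n - (1 + (1 / 2 : ℝ) ^ n) • f n).le_of_opNorm_le (hg n) x
    rw [sub_apply, smul_apply, smul_eq_mul, Real.norm_eq_abs] at h1
    have h2 := mul_le_mul_of_nonneg_left (hq x) (show (0 : ℝ) ≤ (1 / 2) ^ n / 4 by positivity)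
    linarith
  obtain ⟨n, hn⟩ := hbd x
  have hlow : (1 + (1 / 2 : ℝ) ^ n * (3 / 4)) * q x ≤ g n x := by
    have := (abs_le.1 (herr n)).1
    rw [hn] at this
    linarith
  have hup : ∀ m, |g m x| ≤ (1 + (1 / 2 : ℝ) ^ m * (5 / 4)) * q x := by
    intro m
    have h1 := abs_sub_abs_le_abs_sub (g m x) ((1 + (1 / 2 : ℝ) ^ m) * f m x)
    rw [abs_mul, abs_of_nonneg (show (0 : ℝ) ≤ 1 + (1 / 2) ^ m by positivity)] at h1
    have h2 := mul_le_mul_of_nonneg_left (hf m x) (show (0 : ℝ) ≤ 1 + (1 / 2) ^ m by positivity)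
    have h3 := herr m
    linarith
  -- For `m > n` the excess is at most `5/8 * (1/2) ^ n`, below the `3/4 * (1/2) ^ n` guaranteed at
  -- `n`.
  have htail : ∀ m, n < m → |g m x| ≤ g n x := by
    intro m hm
    refine (hup m).trans (le_trans (mul_le_mul_of_nonneg_right ?_ hq0) hlow)
    have : (1 / 2 : ℝ) ^ m ≤ (1 / 2) ^ (n + 1) :=
      pow_le_pow_of_le_one (by norm_num) (by norm_num) hm
    have h0 : (0 : ℝ) < (1 / 2) ^ n := by positivity
    rw [pow_succ] at this
    linarith
  have hqn : q x ≤ g n x := by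
    refine le_trans ?_ hlow
    have : (0 : ℝ) ≤ (1 / 2) ^ n * (3 / 4) * q x := by positivity
    linarith
  obtain ⟨k, -, hk⟩ := (Finset.range (n + 1)).exists_max_image (fun m => |g m x|) ⟨0, by simp⟩
  have hnk : g n x ≤ |g k x| := (le_abs_self _).trans (hk n (by simp))
  refine ⟨k, hqn.trans hnk, fun m => ?_⟩
  rcases lt_or_ge n m with h | h
  · exact (htail m h).trans hnk
  · exact hk m (by simpa [Nat.lt_succ_iff] using h)

theorem Seminorm.continuous_of_le_mul_norm {p : Seminorm ℝ E} {M : ℝ} (h : ∀ x, p x ≤ M * ‖x‖) :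
    Continuous p := by
  refine Seminorm.continuous_of_le (q := M.toNNReal • normSeminorm ℝ E) ?_ ?_
  · exact continuous_norm.const_smul M.toNNReal
  · exact fun x => (h x).trans (mul_le_mul_of_nonneg_right (Real.le_coe_toNNReal M) (norm_nonneg x))

/-- A functional in the span of the coordinates depends on finitely many coordinates only. -/
theorem SchauderBasis.exists_comp_proj_eq (b : SchauderBasis ℝ E) {g : StrongDual ℝ E}
    (hg : g ∈ Submodule.span ℝ (Set.range b.coord)) :
    ∃ K, ∀ k ≥ K, ∀ x, g (SchauderBasis.proj b k x) = g x := by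
  induction hg using Submodule.span_induction with
  | mem g hg =>
    obtain ⟨i, rfl⟩ := hg
    refine ⟨i + 1, fun k hk x => ?_⟩
    have hik : i < k := hk
    simp [b.ortho, Pi.single_apply, hik]
  | zero => exact ⟨0, by simp⟩
  | add g h _ _ ihg ihh =>
    obtain ⟨K, hK⟩ := ihg
    obtain ⟨L, hL⟩ := ihh
    refine ⟨max K L, fun k hk x => ?_⟩
    rw [add_apply, add_apply, hK k (le_of_max_le_left hk), hL k (le_of_max_le_right hk)]
  | smul a g _ ih =>
    obtain ⟨K, hK⟩ := ih
    exact ⟨K, fun k hk x => by rw [smul_apply, smul_apply, hK k hk]⟩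

/-- If the coordinates span a dense subspace of the dual and some equivalent norm has a countable
boundary, then the space has a monotone attaining renorming. -/
theorem hasMonotoneAttainingRenorming_of_boundary [CompleteSpace E] (b : SchauderBasis ℝ E)
    (hd : Dense (Submodule.span ℝ (Set.range b.coord) : Set (StrongDual ℝ E)))
    {q : Seminorm ℝ E} (hq : IsEquivalentNorm q) {f : ℕ → StrongDual ℝ E}
    (hf : ∀ n x, |f n x| ≤ q x) (hbd : ∀ x, ∃ n, f n x = q x) :
    HasMonotoneAttainingRenorming b := by
  obtain ⟨c, C, hc, hC, hcC⟩ := hq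
  have hfC : ∀ n, ‖f n‖ ≤ C := fun n =>
    (f n).opNorm_le_bound hC.le fun x => (hf n x).trans (hcC x).2
  have hex : ∀ n, ∃ g ∈ Submodule.span ℝ (Set.range b.coord),
      ‖g - (1 + (1 / 2 : ℝ) ^ n) • f n‖ ≤ c / 4 * (1 / 2) ^ n := by
    intro n
    obtain ⟨g, hg, h⟩ := hd.exists_dist_lt ((1 + (1 / 2 : ℝ) ^ n) • f n)
      (show 0 < c / 4 * (1 / 2) ^ n by positivity)
    rw [dist_comm, dist_eq_norm] at h
    exact ⟨g, hg, h.le⟩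
  choose g hgspan hg using hex
  have hgq := exists_forall_abs_le_of_close (fun x => (hcC x).1) hf hbd hg
  have hgM : ∀ n, ‖g n‖ ≤ 2 * C + c := by
    intro n
    have h1 : (1 / 2 : ℝ) ^ n ≤ 1 := pow_le_one₀ (by norm_num) (by norm_num)
    have h0 : (0 : ℝ) < (1 / 2) ^ n := by positivity
    have h2 := norm_sub_norm_le (g n) ((1 + (1 / 2 : ℝ) ^ n) • f n)
    rw [norm_smul, Real.norm_eq_abs, abs_of_pos (by linarith)] at h2
    have h3 : (1 + (1 / 2 : ℝ) ^ n) * ‖f n‖ ≤ 2 * C :=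
      mul_le_mul (by linarith) (hfC n) (norm_nonneg _) (by norm_num)
    have h4 : c / 4 * (1 / 2) ^ n ≤ c / 4 * 1 := mul_le_mul_of_nonneg_left h1 (by positivity)
    linarith [hg n]
  obtain ⟨M, hM⟩ := SchauderBasis.exists_norm_proj_le b
  have hM0 : 0 ≤ M := (norm_nonneg _).trans (hM 0)
  have hgM0 : 0 ≤ 2 * C + c := by positivity
  obtain ⟨p₀, hp₀, hp₀'⟩ := exists_seminorm_eq_iSup g hgM
  have hφM : ∀ i : ℕ × ℕ, ‖(g i.1).comp (SchauderBasis.proj b i.2)‖ ≤ (2 * C + c) * M := fun i =>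
    ((g i.1).opNorm_comp_le _).trans (mul_le_mul (hgM _) (hM _) (norm_nonneg _) hgM0)
  -- This is the supremum of `p₀` over all partial sums; projections compose to projections, which
  -- gives monotonicity.
  obtain ⟨p, hp, hp'⟩ := exists_seminorm_eq_iSup
    (fun i : ℕ × ℕ => (g i.1).comp (SchauderBasis.proj b i.2)) hφM
  have hp₀cont : Continuous p₀ := Seminorm.continuous_of_le_mul_norm (M := 2 * C + c) fun x =>
    hp₀' x _ fun n => (g n).le_of_opNorm_le (hgM n) x
  have hPle : ∀ m n x, |g n (SchauderBasis.proj b m x)| ≤ p x := fun m n x => hp (n, m) x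
  have hpP : ∀ k x, p (SchauderBasis.proj b k x) ≤ p x := fun k x => by
    refine hp' _ _ fun i => ?_
    rw [ContinuousLinearMap.comp_apply, SchauderBasis.proj_comp]
    exact hPle _ _ _
  refine ⟨p, ⟨c, (2 * C + c) * M + 1, hc, by positivity, fun x => ⟨?_, ?_⟩⟩, ?_, fun x => ?_⟩
  · obtain ⟨n, hn, -⟩ := hgq x
    obtain ⟨K, hK⟩ := SchauderBasis.exists_comp_proj_eq b (hgspan n)
    rw [← hK K le_rfl x] at hn
    exact (hcC x).1.trans (hn.trans (hPle _ _ _))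
  · refine hp' _ _ fun i => ?_
    have h1 := ContinuousLinearMap.le_of_opNorm_le _ (hφM i) x
    rw [Real.norm_eq_abs] at h1
    linarith [norm_nonneg x]
  · intro a k
    have h : ∑ i ∈ Finset.range k, a i • b i =
        SchauderBasis.proj b k (∑ i ∈ Finset.range (k + 1), a i • b i) := by
      rw [map_sum, Finset.sum_range_succ]
      simp only [map_smul, SchauderBasis.proj_apply_basis_mem, lt_irrefl, if_false, smul_zero,
        add_zero]
      exact Finset.sum_congr rfl fun i hi => by rw [if_pos (Finset.mem_range.1 hi)]
    rw [h]
    exact hpP _ _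
  · have ht : Tendsto (fun k => p₀ (SchauderBasis.proj b k x)) atTop (𝓝 (p₀ x)) :=
      (hp₀cont.tendsto x).comp (SchauderBasis.tendsto_proj b x)
    obtain ⟨n, -, hn⟩ := hgq x
    obtain ⟨K, hK⟩ := SchauderBasis.exists_comp_proj_eq b (hgspan n)
    -- The `g n` attaining `p₀ x` sees only the first `K` coordinates, so `p₀ x ≤ p₀ (P K x)`.
    obtain ⟨m, hm⟩ := exists_forall_le_of_tendsto ht (K := K) (by
      refine hp₀' x _ fun i => (hn i).trans ?_
      rw [← hK K le_rfl x]
      exact hp₀ n _)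
    refine ⟨m, ?_⟩
    rw [← SchauderBasis.proj_apply]
    refine le_antisymm (hp' _ _ fun i => ?_) (hpP m x)
    refine ((hp₀ i.1 _).trans (hm i.2)).trans (hp₀' _ _ fun j => ?_)
    have := hPle m j (SchauderBasis.proj b m x)
    rwa [SchauderBasis.proj_comp, min_self] at this

end SupSeminorm

/-- A polyhedral renorming yields a monotone attaining renorming, if the coordinates span a dense
subspace of the dual as soon as the dual is separable. -/
theorem IsIsomorphicallyPolyhedral.hasMonotoneAttainingRenorming {E : Type u}
    [NormedAddCommGroup E] [NormedSpace ℝ E] [CompleteSpace E] (h : IsIsomorphicallyPolyhedral E)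
    (b : SchauderBasis ℝ E)
    (hd : TopologicalSpace.SeparableSpace (StrongDual ℝ E) →
      Dense (Submodule.span ℝ (Set.range b.coord) : Set (StrongDual ℝ E))) :
    HasMonotoneAttainingRenorming b := by
  obtain ⟨X, _, _, _, hX, ⟨T⟩⟩ := h
  have := SchauderBasis.separableSpace b
  have : TopologicalSpace.SeparableSpace X :=
    T.surjective.denseRange.separableSpace T.continuous
  obtain ⟨f, hf, hbd⟩ := hX.exists_countable_boundary
  have hsep : TopologicalSpace.SeparableSpace (StrongDual ℝ E) := by
    have := separableSpace_dual_of_boundary hf hbd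
    let S : StrongDual ℝ X → StrongDual ℝ E := fun g => g.comp (T : E →L[ℝ] X)
    have hS : Function.Surjective S := fun g => ⟨g.comp (T.symm : X →L[ℝ] E), by ext; simp [S]⟩
    exact hS.denseRange.separableSpace (by fun_prop)
  refine hasMonotoneAttainingRenorming_of_boundary b (hd hsep)
    (q := (normSeminorm ℝ X).comp (T : E →L[ℝ] X).toLinearMap)
    (f := fun n => (f n).comp (T : E →L[ℝ] X)) ?_ ?_ ?_
  · refine ⟨(‖(T.symm : X →L[ℝ] E)‖ + 1)⁻¹, ‖(T : E →L[ℝ] X)‖ + 1, by positivity, by positivity,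
      fun x => ⟨?_, ?_⟩⟩
    · rw [inv_mul_le_iff₀ (by positivity)]
      have := (T.symm : X →L[ℝ] E).le_opNorm (T x)
      simp at this ⊢
      linarith [norm_nonneg (T x)]
    · have := (T : E →L[ℝ] X).le_opNorm x
      simp at this ⊢
      linarith [norm_nonneg x]
  · intro n x
    exact ((f n).le_of_opNorm_le (hf n) (T x)).trans_eq (one_mul _)
  · exact fun x => hbd (T x)

/-! ### The space under an equivalent norm -/

section Renormed

variable {E : Type u} [NormedAddCommGroup E] [NormedSpace ℝ E]

/-- A copy of `E` carrying the equivalent norm `q`. -/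
def Renormed (q : Seminorm ℝ E) (_ : IsEquivalentNorm q) : Type u := E

variable {q : Seminorm ℝ E} {h : IsEquivalentNorm q}

instance : AddCommGroup (Renormed q h) := inferInstanceAs (AddCommGroup E)

instance : Module ℝ (Renormed q h) := inferInstanceAs (Module ℝ E)

noncomputable instance : NormedAddCommGroup (Renormed q h) :=
  AddGroupNorm.toNormedAddCommGroup
    { toFun := fun x => q (show E from x)
      map_zero' := map_zero q
      add_le' := map_add_le_add q
      neg' := map_neg_eq_map q
      eq_zero_of_map_eq_zero' := fun x hx => by
        have h' := h
        obtain ⟨c, C, hc, -, hcC⟩ := h'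
        have h1 := (hcC x).1
        have h2 : q (show E from x) = 0 := hx
        have h3 : ‖(show E from x)‖ ≤ 0 := by
          refine le_of_mul_le_mul_left ?_ hc
          rw [mul_zero]
          exact h1.trans h2.le
        exact norm_le_zero_iff.1 h3 }

noncomputable instance : NormedSpace ℝ (Renormed q h) where
  norm_smul_le a x := (map_smul_eq_mul q a (show E from x)).le

/-- The identity map onto the renormed space. -/
noncomputable def toRenormed (q : Seminorm ℝ E) (h : IsEquivalentNorm q) : E ≃L[ℝ] Renormed q h :=
  -- The two bounds are the constants `C` and `c⁻¹` contained in `h`.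
  LinearEquiv.toContinuousLinearEquivOfBounds
    (show E ≃ₗ[ℝ] Renormed q h from LinearEquiv.refl ℝ E) h.choose_spec.choose h.choose⁻¹
    (fun x => (h.choose_spec.choose_spec.2.2 x).2) fun x => by
      rw [← div_eq_inv_mul, le_div_iff₀' h.choose_spec.choose_spec.1]
      exact (h.choose_spec.choose_spec.2.2 _).1

theorem norm_toRenormed (x : E) : ‖toRenormed q h x‖ = q x := rfl

instance [CompleteSpace E] : CompleteSpace (Renormed q h) :=
  (completeSpace_congr (e := (toRenormed q h).toEquiv) (toRenormed q h).isUniformEmbedding).1 inferInstance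

theorem IsEquivalentNorm.continuous (h : IsEquivalentNorm q) : Continuous q :=
  ((toRenormed q h).continuous.norm).congr norm_toRenormed

theorem IsEquivalentNorm.exists_dual_eq (h : IsEquivalentNorm q) (x : E) :
    ∃ f : StrongDual ℝ E, (∀ y, |f y| ≤ q y) ∧ f x = q x := by
  obtain ⟨g, hg, hgx⟩ := exists_dual_vector'' ℝ (toRenormed q h x)
  exact ⟨g.comp (toRenormed q h : E →L[ℝ] Renormed q h),
    fun y => (g.le_of_opNorm_le hg _).trans_eq (one_mul _), hgx⟩

end Renormed

/-! ### Locally finite maxima are polyhedral -/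

section Polyhedral

variable {X : Type*} [NormedAddCommGroup X] [NormedSpace ℝ X]

/-- A norm that is locally, off the origin, a maximum of finitely many functionals is
polyhedral. -/
theorem isPolyhedralSpace_of_locally_finite
    (h : ∀ x : X, x ≠ 0 → ∃ Ψ : Finset (StrongDual ℝ X), (∀ ψ ∈ Ψ, ∀ z, ψ z ≤ ‖z‖) ∧
      ∀ᶠ y in 𝓝 x, ∃ ψ ∈ Ψ, ψ y = ‖y‖) : IsPolyhedralSpace X := by
  classical
  intro F hF
  have hK : IsCompact (Metric.sphere (0 : F) 1) := isCompact_sphere 0 1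
  -- Finitely many of the local families cover the compact unit sphere of `F`; their union works on
  -- all of it.
  obtain ⟨Ψ, hΨ, hmax⟩ : ∃ Ψ : Finset (StrongDual ℝ X), (∀ ψ ∈ Ψ, ∀ z, ψ z ≤ ‖z‖) ∧
      ∀ y ∈ Metric.sphere (0 : F) 1, ∃ ψ ∈ Ψ, ψ y = ‖(y : X)‖ := by
    refine hK.induction_on (p := fun s => ∃ Ψ : Finset (StrongDual ℝ X),
      (∀ ψ ∈ Ψ, ∀ z, ψ z ≤ ‖z‖) ∧ ∀ y ∈ s, ∃ ψ ∈ Ψ, ψ y = ‖(y : X)‖) ⟨∅, by simp, by simp⟩ ?_ ?_ ?_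
    · rintro s t hst ⟨Ψ, h1, h2⟩
      exact ⟨Ψ, h1, fun y hy => h2 y (hst hy)⟩
    · rintro s t ⟨Ψ, h1, h2⟩ ⟨Ψ', h1', h2'⟩
      refine ⟨Ψ ∪ Ψ', ?_, ?_⟩
      · intro ψ hψ
        rcases Finset.mem_union.1 hψ with hψ | hψ
        exacts [h1 ψ hψ, h1' ψ hψ]
      · rintro y (hy | hy)
        · obtain ⟨ψ, hψ, e⟩ := h2 y hy
          exact ⟨ψ, Finset.mem_union_left _ hψ, e⟩
        · obtain ⟨ψ, hψ, e⟩ := h2' y hy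
          exact ⟨ψ, Finset.mem_union_right _ hψ, e⟩
    · intro x hx
      have hx0 : (x : X) ≠ 0 := fun h0 => by
        have : ‖(x : X)‖ = 1 := by simpa using hx
        simp [h0] at this
      obtain ⟨Ψ, h1, h2⟩ := h x hx0
      exact ⟨_, nhdsWithin_le_nhds (continuous_subtype_val.continuousAt.eventually h2), Ψ, h1,
        fun y hy => hy⟩
  refine ⟨Ψ.image fun ψ => (ψ.comp F.subtypeL, 1), ?_⟩
  ext y
  rw [mem_closedBall_zero_iff, Set.mem_ofPred_eq]
  constructor
  · intro hy p hp
    obtain ⟨ψ, hψ, rfl⟩ := Finset.mem_image.1 hp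
    exact (hΨ ψ hψ y).trans hy
  · intro hy
    rcases eq_or_ne y 0 with rfl | hy0
    · simp
    have hy0' := norm_pos_iff.2 hy0
    obtain ⟨ψ, hψ, e⟩ := hmax (‖y‖⁻¹ • y) (by
      rw [mem_sphere_zero_iff_norm, norm_smul, norm_inv, norm_norm, inv_mul_cancel₀ hy0'.ne'])
    have h1 := hy _ (Finset.mem_image_of_mem _ hψ)
    have h2 : ψ (y : X) = ‖y‖ := by
      rw [Submodule.coe_smul, map_smul, norm_smul, smul_eq_mul, norm_inv, norm_norm] at e
      exact mul_left_cancel₀ (inv_ne_zero hy0'.ne') e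
    exact h2.symm.le.trans h1

end Polyhedral

/-! ### From a monotone attaining norm to a polyhedral one -/

section MonotoneAttaining

variable {E : Type u} [NormedAddCommGroup E] [NormedSpace ℝ E]

/-- On a finite dimensional range, a norm is almost a maximum of finitely many functionals. -/
theorem IsEquivalentNorm.exists_finset_le_comp {p : Seminorm ℝ E} (hp : IsEquivalentNorm p)
    (P : E →L[ℝ] E) [FiniteDimensional ℝ P.toLinearMap.range] {θ : ℝ} (hθ : θ < 1) :
    ∃ Φ : Finset (StrongDual ℝ E), (∀ φ ∈ Φ, ∀ x, |φ x| ≤ p (P x)) ∧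
      ∀ x, ∃ φ ∈ Φ, θ * p (P x) ≤ φ x := by
  classical
  let V := P.toLinearMap.range
  have hK : IsCompact {v : V | p v = 1} := by
    refine Metric.isCompact_of_isClosed_isBounded
      (isClosed_eq (hp.continuous.comp continuous_subtype_val) continuous_const) ?_
    obtain ⟨c, C, hc, -, hcC⟩ := hp
    refine (Metric.isBounded_closedBall (x := (0 : V)) (r := c⁻¹)).subset fun v hv => ?_
    have hv : p v = 1 := hv
    rw [mem_closedBall_zero_iff, ← one_div, le_div_iff₀' hc, ← hv]
    exact (hcC v).1
  obtain ⟨Φ, hΦ, hmax⟩ : ∃ Φ : Finset (StrongDual ℝ E), (∀ φ ∈ Φ, ∀ x, |φ x| ≤ p x) ∧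
      ∀ v ∈ {v : V | p v = 1}, ∃ φ ∈ Φ, θ < φ v := by
    refine hK.induction_on (p := fun s => ∃ Φ : Finset (StrongDual ℝ E),
      (∀ φ ∈ Φ, ∀ x, |φ x| ≤ p x) ∧ ∀ v ∈ s, ∃ φ ∈ Φ, θ < φ v) ⟨∅, by simp, by simp⟩ ?_ ?_ ?_
    · rintro s t hst ⟨Φ, h1, h2⟩
      exact ⟨Φ, h1, fun y hy => h2 y (hst hy)⟩
    · rintro s t ⟨Φ, h1, h2⟩ ⟨Φ', h1', h2'⟩
      refine ⟨Φ ∪ Φ', ?_, ?_⟩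
      · intro φ hφ
        rcases Finset.mem_union.1 hφ with hφ | hφ
        exacts [h1 φ hφ, h1' φ hφ]
      · rintro y (hy | hy)
        · obtain ⟨φ, hφ, e⟩ := h2 y hy
          exact ⟨φ, Finset.mem_union_left _ hφ, e⟩
        · obtain ⟨φ, hφ, e⟩ := h2' y hy
          exact ⟨φ, Finset.mem_union_right _ hφ, e⟩
    · intro v hv
      obtain ⟨φ, h1, h2⟩ := hp.exists_dual_eq (v : E)
      have hv : p v = 1 := hv
      have hev : ∀ᶠ w : V in 𝓝 v, θ < φ w :=
        ((φ.continuous.comp continuous_subtype_val).tendsto v).eventually_const_lt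
          (show θ < φ v by rw [h2, hv]; exact hθ)
      exact ⟨_, nhdsWithin_le_nhds hev, {φ}, by simpa using h1, fun w hw => ⟨φ, by simp, hw⟩⟩
  -- The functional `0` serves the points with `p (P x) = 0`.
  refine ⟨insert 0 (Φ.image fun φ => φ.comp P), ?_, fun x => ?_⟩
  · intro φ hφ x
    rcases Finset.mem_insert.1 hφ with rfl | hφ
    · simp
    · obtain ⟨ψ, hψ, rfl⟩ := Finset.mem_image.1 hφ
      exact hΦ ψ hψ (P x)
  · rcases (apply_nonneg p (P x)).eq_or_lt with h0 | h0
    · exact ⟨0, by simp, by simp [← h0]⟩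
    · let v : V := ⟨(p (P x))⁻¹ • P x, Submodule.smul_mem _ _ ⟨x, rfl⟩⟩
      obtain ⟨φ, hφ, h⟩ := hmax v (by
        change p ((p (P x))⁻¹ • P x) = 1
        rw [map_smul_eq_mul, Real.norm_eq_abs, abs_of_pos (inv_pos.2 h0), inv_mul_cancel₀ h0.ne'])
      refine ⟨φ.comp P, Finset.mem_insert_of_mem (Finset.mem_image_of_mem _ hφ), ?_⟩
      have h : θ < φ ((p (P x))⁻¹ • P x) := h
      rw [map_smul, smul_eq_mul, ← div_eq_inv_mul, lt_div_iff₀ h0] at h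
      exact h.le

theorem IsMonotoneFor.apply_proj_le {b : SchauderBasis ℝ E} {p : Seminorm ℝ E}
    (hm : IsMonotoneFor b p) (hp : Continuous p) (n : ℕ) (x : E) :
    p (SchauderBasis.proj b n x) ≤ p x := by
  have hmono : Monotone fun k => p (SchauderBasis.proj b k x) := monotone_nat_of_le_succ fun k => by
    simpa only [SchauderBasis.proj_apply] using hm (fun i => b.coord i x) k
  exact hmono.ge_of_tendsto ((hp.tendsto x).comp (SchauderBasis.tendsto_proj b x)) n

/-- A monotone attaining norm can be replaced by one that is locally, off the origin, a maximum
of finitely many functionals. -/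
theorem HasMonotoneAttainingRenorming.exists_locally_finite {b : SchauderBasis ℝ E}
    (h : HasMonotoneAttainingRenorming b) :
    ∃ q : Seminorm ℝ E, IsEquivalentNorm q ∧ ∀ x ≠ 0, ∃ Ψ : Finset (StrongDual ℝ E),
      (∀ ψ ∈ Ψ, ∀ z, ψ z ≤ q z) ∧ ∀ᶠ y in 𝓝 x, ∃ ψ ∈ Ψ, ψ y = q y := by
  classical
  obtain ⟨p, hp, hmono, hatt⟩ := h
  have hP := hmono.apply_proj_le hp.continuous
  have hcont := hp.continuous
  have hpos : ∀ x ≠ 0, 0 < p x := by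
    intro x hx
    obtain ⟨c, C, hc, -, hcC⟩ := hp
    exact (mul_pos hc (norm_pos_iff.2 hx)).trans_le (hcC x).1
  let w : ℕ → ℝ := fun n => 1 + (1 / 2) ^ n
  have hw1 : ∀ n, 1 < w n := fun n => lt_add_of_pos_right _ (by positivity)
  have hw2 : ∀ n, w n ≤ 2 := fun n => by
    have : (1 / 2 : ℝ) ^ n ≤ 1 := pow_le_one₀ (by norm_num) (by norm_num)
    change 1 + (1 / 2 : ℝ) ^ n ≤ 2
    linarith
  have hwanti : ∀ m n, m < n → w n ≤ w (m + 1) := fun m n h => by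
    have : (1 / 2 : ℝ) ^ n ≤ (1 / 2) ^ (m + 1) :=
      pow_le_pow_of_le_one (by norm_num) (by norm_num) h
    change 1 + (1 / 2 : ℝ) ^ n ≤ 1 + (1 / 2) ^ (m + 1)
    linarith
  have hwlt : ∀ m, w (m + 1) < w m := fun m => by
    have : (0 : ℝ) < (1 / 2) ^ m := by positivity
    change 1 + (1 / 2 : ℝ) ^ (m + 1) < 1 + (1 / 2) ^ m
    rw [pow_succ]; linarith
  have hw0 : ∀ n, 0 < w n := fun n => one_pos.trans (hw1 n)
  -- level `n` consists of functionals below `w n * p ∘ P n` whose maximum exceeds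
  -- `w (n + 1) * p ∘ P n`
  have hex : ∀ n, ∃ Φ : Finset (StrongDual ℝ E),
      (∀ φ ∈ Φ, ∀ x, |φ x| ≤ w n * p (SchauderBasis.proj b n x)) ∧
      ∀ x, 0 < p (SchauderBasis.proj b n x) →
        ∃ φ ∈ Φ, w (n + 1) * p (SchauderBasis.proj b n x) < φ x := by
    intro n
    -- With `θ` above `w (n + 1) / w n`, scaling a `θ`-norming family by `w n` exceeds `w (n + 1)`.
    obtain ⟨θ, hθ1, hθ2⟩ := exists_between ((div_lt_one (hw0 n)).2 (hwlt n))
    have : FiniteDimensional ℝ (SchauderBasis.proj b n).toLinearMap.range := by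
      rw [SchauderBasis.range_proj_eq_span]
      exact FiniteDimensional.span_of_finite ℝ ((Finset.finite_toSet _).image _)
    obtain ⟨Φ, h1, h2⟩ := hp.exists_finset_le_comp (SchauderBasis.proj b n) hθ2
    refine ⟨Φ.image fun φ => w n • φ, ?_, fun x hx => ?_⟩
    · intro φ hφ x
      obtain ⟨ψ, hψ, rfl⟩ := Finset.mem_image.1 hφ
      rw [smul_apply, smul_eq_mul, abs_mul, abs_of_pos (hw0 n)]
      exact mul_le_mul_of_nonneg_left (h1 ψ hψ x) (hw0 n).le
    · obtain ⟨φ, hφ, h⟩ := h2 x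
      refine ⟨_, Finset.mem_image_of_mem _ hφ, ?_⟩
      rw [smul_apply, smul_eq_mul]
      rw [div_lt_iff₀' (hw0 n)] at hθ1
      calc w (n + 1) * p (SchauderBasis.proj b n x)
          < w n * θ * p (SchauderBasis.proj b n x) := mul_lt_mul_of_pos_right hθ1 hx
        _ ≤ w n * φ x := by
          rw [mul_assoc]; exact mul_le_mul_of_nonneg_left h (hw0 n).le
  choose Φ hΦ hΦmax using hex
  have hle : ∀ n, ∀ φ ∈ Φ n, ∀ x, |φ x| ≤ w n * p x := fun n φ hφ x =>
    (hΦ n φ hφ x).trans (mul_le_mul_of_nonneg_left (hP n x) (hw0 n).le)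
  have hnear : ∀ x ≠ 0, ∃ m, ∃ φ ∈ Φ m, w (m + 1) * p x < φ x := by
    intro x hx
    obtain ⟨m, hm⟩ := hatt x
    rw [← SchauderBasis.proj_apply] at hm
    obtain ⟨φ, hφ, h⟩ := hΦmax m x (hm ▸ hpos x hx)
    exact ⟨m, φ, hφ, hm ▸ h⟩
  obtain ⟨c, C, hc, hC, hcC⟩ := hp
  -- The extra index carries the zero functional and keeps the family nonempty.
  let I := Option (Σ n, {φ // φ ∈ Φ n})
  obtain ⟨q, hq, hq'⟩ := exists_seminorm_eq_iSup
    (fun i : I => i.elim 0 fun i => (i.2 : StrongDual ℝ E)) (M := 2 * C) (by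
      rintro (_ | ⟨n, φ, hφ⟩)
      · simpa using hC.le
      · refine ContinuousLinearMap.opNorm_le_bound _ (by positivity) fun x =>
          (hle n φ hφ x).trans ?_
        rw [mul_assoc]
        exact mul_le_mul (hw2 n) (hcC x).2 (apply_nonneg p x) (by norm_num))
  have hqΦ : ∀ n, ∀ φ ∈ Φ n, ∀ x, |φ x| ≤ q x := fun n φ hφ x => hq (some ⟨n, φ, hφ⟩) x
  refine ⟨q, ⟨c, 2 * C, hc, by positivity, fun x => ⟨?_, ?_⟩⟩, fun x hx => ?_⟩
  · rcases eq_or_ne x 0 with rfl | hx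
    · simp
    obtain ⟨m, φ, hφ, h⟩ := hnear x hx
    have h1 := (le_abs_self _).trans (hqΦ m φ hφ x)
    have h2 := mul_le_mul_of_nonneg_right (hw1 (m + 1)).le (apply_nonneg p x)
    linarith [(hcC x).1]
  · refine hq' x _ ?_
    rintro (_ | ⟨n, φ, hφ⟩)
    · simpa using by positivity
    · refine (hle n φ hφ x).trans ?_
      rw [mul_assoc]
      exact mul_le_mul (hw2 n) (hcC x).2 (apply_nonneg p x) (by norm_num)
  · obtain ⟨m, φ, hφ, h⟩ := hnear x hx
    let Ψ := (Finset.range (m + 1)).biUnion Φ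
    have hφΨ : φ ∈ Ψ := Finset.mem_biUnion.2 ⟨m, by simp, hφ⟩
    have hΨq : ∀ ψ ∈ Ψ, ∀ z, |ψ z| ≤ q z := by
      intro ψ hψ z
      obtain ⟨n, -, hn⟩ := Finset.mem_biUnion.1 hψ
      exact hqΦ n ψ hn z
    refine ⟨Ψ ∪ Ψ.image fun ψ => -ψ, ?_, ?_⟩
    · intro ψ hψ z
      rcases Finset.mem_union.1 hψ with hψ | hψ
      · exact (le_abs_self _).trans (hΨq ψ hψ z)
      · obtain ⟨χ, hχ, rfl⟩ := Finset.mem_image.1 hψ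
        exact (neg_le_abs _).trans (hΨq χ hχ z)
    -- The strict inequality persists near `x`, and there levels `n > m` stay below `w (m + 1) * p y
    -- < φ y`, so they do not affect the supremum.
    · have hev : ∀ᶠ y in 𝓝 x, w (m + 1) * p y < φ y :=
        ContinuousAt.eventually_lt (by fun_prop) (by fun_prop) h
      filter_upwards [hev] with y hy
      obtain ⟨ψ, hψ, hmax⟩ := Ψ.exists_max_image (fun ψ => |ψ y|) ⟨φ, hφΨ⟩
      have hqy : q y = |ψ y| := by
        refine le_antisymm (hq' y _ ?_) (hΨq ψ hψ y)
        rintro (_ | ⟨n, χ, hχ⟩)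
        · simp
        · rcases lt_or_ge m n with hmn | hmn
          · refine (hle n χ hχ y).trans ?_
            refine (mul_le_mul_of_nonneg_right (hwanti m n hmn) (apply_nonneg p y)).trans ?_
            exact hy.le.trans ((le_abs_self _).trans (hmax φ hφΨ))
          · exact hmax χ (Finset.mem_biUnion.2 ⟨n, by simpa [Nat.lt_succ_iff] using hmn, hχ⟩)
      rcases abs_choice (ψ y) with e | e
      · exact ⟨ψ, Finset.mem_union_left _ hψ, by rw [hqy, e]⟩
      · exact ⟨-ψ, Finset.mem_union_right _ (Finset.mem_image_of_mem _ hψ), by rw [hqy, e]; rfl⟩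

/-- A space with a monotone attaining renorming is isomorphically polyhedral. -/
theorem HasMonotoneAttainingRenorming.isIsomorphicallyPolyhedral [CompleteSpace E]
    {b : SchauderBasis ℝ E} (h : HasMonotoneAttainingRenorming b) :
    IsIsomorphicallyPolyhedral E := by
  classical
  obtain ⟨q, hq, hloc⟩ := h.exists_locally_finite
  let T := toRenormed q hq
  refine ⟨Renormed q hq, inferInstance, inferInstance, inferInstance,
    isPolyhedralSpace_of_locally_finite fun x hx => ?_, ⟨T⟩⟩
  have hT : ∀ z, q (T.symm z) = ‖z‖ := fun z => by
    rw [← norm_toRenormed (h := hq)]; exact congrArg norm (T.apply_symm_apply z)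
  obtain ⟨Ψ, h1, h2⟩ := hloc (T.symm x) (by simpa using hx)
  refine ⟨Ψ.image fun ψ => ψ.comp (T.symm : Renormed q hq →L[ℝ] E), ?_, ?_⟩
  · intro ψ hψ z
    obtain ⟨φ, hφ, rfl⟩ := Finset.mem_image.1 hψ
    exact (h1 φ hφ (T.symm z)).trans_eq (hT z)
  · filter_upwards [(T.symm.continuous.tendsto x).eventually h2] with y hy
    obtain ⟨ψ, hψ, e⟩ := hy
    exact ⟨_, Finset.mem_image_of_mem _ hψ, e.trans (hT y)⟩

end MonotoneAttaining

theorem mainTheorem1 {E : Type u} [NormedAddCommGroup E] [NormedSpace ℝ E] [CompleteSpace E]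
    (b : SchauderBasis ℝ E) :
    (IsShrinkingBasis b → (IsIsomorphicallyPolyhedral E ↔ HasMonotoneAttainingRenorming b)) ∧
    (IsUnconditionalBasis b →
      (IsIsomorphicallyPolyhedral E ↔ HasMonotoneAttainingRenorming b)) :=
  ⟨fun hb => ⟨fun h => h.hasMonotoneAttainingRenorming b fun _ => hb.dense_span_coord,
      fun h => h.isIsomorphicallyPolyhedral⟩,
    fun hb => ⟨fun h => h.hasMonotoneAttainingRenorming b fun _ => hb.dense_span_coord,
      fun h => h.isIsomorphicallyPolyhedral⟩⟩
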